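/- **Setting.** Consider a deterministic system $x_{k+1}=f(x_k)$, $y_k=h(x_k)$ on a Borel domain $\mathcal D\subseteq\mathbb R^n$, with $f$, $h$ Borel measurable on $\mathcal D$ and a finite output alphabet $\mathcal Y$; once a trajectory has left $\mathcal D$, the output is a special symbol $y^\dagger\in\mathcal Y$ forever. Initial states are drawn from a probability measure $\mathcal P$ on $\mathcal D$ (write $\mathbb P$ for its probabilities). Let $\ell\ge 1$. For $w\in\mathcal Y^\ell$ let $[w]\subseteq\mathcal D$ be the set of initial states whose outputs at times $0,\dots,\ell-1$ are $w$. For $S\subseteq\mathcal D$ let $\mathrm{Pre}^i_{\mathcal D}(S)=\{x\in\mathcal D : f^i(x)\in S,\ f^j(x)\in\mathcal D \text{ for } 0\le j\le i\}$ and, for $0\le k\le\infty$, $\mu_0^k(S)=\mathbb P\big[\bigcup_{i=0}^{k}\mathrm{Pre}^i_{\mathcal D}(S)\big]$ (the union being over all $i\ge 0$ if $k=\infty$). **Assumption 1.** There is a monotonically increasing $\varphi:\mathbb N\to\mathbb R$ with $\mu_0^k(S)\ge\varphi(k)\,\mu_0^\infty(S)$ for all $k\in\mathbb N$ and all $S=\bigcup_{w\in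 J}[w]$, $J\subseteq\mathcal Y^\ell$. **Abstraction.** Draw $x_{0,1},\dots,x_{0,N}$ i.i.d. from $\mathcal P$ and observe the outputs of each trajectory at times $0,\dots,H-1$. Let $\mathcal X_\ell^N\subseteq\mathcal Y^\ell$ be the set of $\ell$-sequences that occur as blocks of consecutive outputs in these $N$ sequences. The data-driven $\ell$-complete abstraction $\mathcal S_\ell^N$ is the transition system with state set $\mathcal X_\ell^N$, all states initial, a transition $k\sigma\to\sigma k'$ whenever both are states ($k,k'\in\mathcal Y$, $\sigma\in\mathcal Y^{\ell-1}$), and output $k$ at state $k\sigma$. The embedding $\mathcal S_{\Sigma}$ of the system is the transition system with state set $\mathcal D$, transitions $(x,x')\in\mathcal D\times\mathcal D$ with $x'=f(x)$, and output $h$. $\mathcal B^\omega(\mathcal S_\Sigma(x_0))$ is the set of infinite output sequences of runs of $\mathcal S_\Sigma$ from $x_0$, $\mathcal B^\omega(\mathcal S_\ell^N)$ that of runs of $\mathcal S_\ell^N$ from any initial state, and $$\mathbb P[\mathcal S_{\Sigma}\preceq_{\mathcal B}\mathcal S_\ell^N]:=\mathbb P\big[x_0:\ \mathcal B^\omega(\mathcal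 S_\Sigma(x_0))\subseteq\mathcal B^\omega(\mathcal S_\ell^N)\big].$$ **Scenario bound.** Let $\delta_i\in\{0,1\}^{\mathcal Y^\ell}$ have $w$-entry $1$ exactly when the $i$-th observed output sequence contains $w$, and consider the scenario program: minimise $\sum_w\theta_w$ over $\theta\in\mathbb R^{\mathcal Y^\ell}$ subject to $\theta-\delta_i\ge 0$, $i=1,\dots,N$. Its complexity $s^*_N$ is the least cardinality of a subset of the $N$ constraints that yields the same solution. For $\beta\in(0,1)$ put $\epsilon(N,\beta,N)=1$ and, for $0\le k<N$, $\epsilon(k,\beta,N)=1-t$, where $t\in(0,1)$ is the unique solution in $(0,1)$ of $$\binom Nk t^{N-k}-\frac{\beta}{N}\sum_{m=k}^{N-1}\binom mk t^{m-k}=0 .$$ **Corollary.** Suppose Assumption 1 holds and $\varphi(\overline k)=1$ for some finite $\overline k\in\mathbb N$, and let $H=\overline k+\ell$. Then for all $N$ and all $\beta\in(0,1)$, with $\overline\epsilon=\epsilon(s_N^*,\beta,N)$, $$\mathbb P^N\Big[\ \mathbb P[\mathcal S_\Sigma\preceq_{\mathcal B}\mathcal S_\ell^N]\ \ge\ 1-\overline\epsilon\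 \Big]\ \ge\ 1-\beta .$$ -/

import Mathlib

open MeasureTheory

noncomputable section

/-! ### Concrete systems -/

/-- A deterministic system `x_{k+1} = f(x_k)`, `y_k = h(x_k)` on a domain `D ⊆ ℝⁿ`, with output
alphabet `Y`. Only the values of `flow` and `out` on `domain` matter. `exitSymbol` is the symbol
`y†` that is output forever once the trajectory has left the domain. -/
structure DynSystem (n : ℕ) (Y : Type*) where
  domain : Set (EuclideanSpace ℝ (Fin n))
  flow : EuclideanSpace ℝ (Fin n) → EuclideanSpace ℝ (Fin n)
  out : EuclideanSpace ℝ (Fin n) → Y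
  exitSymbol : Y

namespace DynSystem

variable {n : ℕ} {Y : Type*} (sys : DynSystem n Y)

/-- The domain and the two maps (on the domain) are Borel measurable. -/
structure IsMeasurable [MeasurableSpace Y] : Prop where
  domain : MeasurableSet sys.domain
  flow : Measurable fun x : sys.domain => sys.flow x
  out : Measurable fun x : sys.domain => sys.out x

open Classical in
/-- The output `y_k` of the system initialised at `x`. -/
def output (x : sys.domain) (k : ℕ) : Y :=
  if ∀ j ≤ k, sys.flow^[j] x ∈ sys.domain then sys.out (sys.flow^[k] x) else sys.exitSymbol

/-- The behaviour of length `H` from `x`, i.e. the outputs at times `0, …, H - 1`. -/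
def finiteBehaviour (H : ℕ) (x : sys.domain) : Fin H → Y := fun k => sys.output x k

/-- The equivalence class `[w]` of an `ℓ`-sequence `w`: the initial states in the domain whose
outputs at times `0, …, ℓ - 1` are `w`. -/
def eqClass {ℓ : ℕ} (w : Fin ℓ → Y) : Set sys.domain := {x | sys.finiteBehaviour ℓ x = w}

/-- `Pre^i_D(S)`: the initial states whose trajectory stays in `D` up to time `i` and is in `S` at
time `i`. -/
def pre (i : ℕ) (S : Set sys.domain) : Set sys.domain :=
  {x | (∀ j ≤ i, sys.flow^[j] x ∈ sys.domain) ∧ sys.flow^[i] x ∈ (Subtype.val '' S)}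

/-- `μ₀ᵏ(S)`: the probability of visiting `S` within the first `k` steps. -/
def visitProb (P : Measure sys.domain) (k : ℕ) (S : Set sys.domain) : ℝ :=
  P.real (⋃ i ∈ Finset.range (k + 1), sys.pre i S)

/-- `μ₀^∞(S)`: the probability of ever visiting `S`. -/
def visitProbInfty (P : Measure sys.domain) (S : Set sys.domain) : ℝ :=
  P.real (⋃ i : ℕ, sys.pre i S)

/-- `φ` is monotonically increasing and `μ₀ᵏ(S) ≥ φ(k) μ₀^∞(S)` for every `k` and every union `S`
of equivalence classes of `ℓ`-sequences. -/
def AttractiveWith (P : Measure sys.domain) (ℓ : ℕ) (φ : ℕ → ℝ) : Prop :=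
  Monotone φ ∧ ∀ (k : ℕ) (J : Set (Fin ℓ → Y)),
    φ k * sys.visitProbInfty P (⋃ w ∈ J, sys.eqClass w)
      ≤ sys.visitProb P k (⋃ w ∈ J, sys.eqClass w)

end DynSystem

/-! ### Transition systems -/

/-- A transition system with state set `X` and output set `Y`. -/
structure TransSystem (X Y : Type*) where
  init : Set X
  edge : X → X → Prop
  out : X → Y

namespace TransSystem

variable {X Y : Type*} (S : TransSystem X Y)

/-- The infinite external behaviours of `S` that start from the state `x`. -/
def behavioursFrom (x : X) : Set (ℕ → Y) :=
  {y | ∃ r : ℕ → X, r 0 = x ∧ (∀ i, S.edge (r i) (r (i + 1))) ∧ ∀ i, y i = S.out (r i)}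

/-- The set `B^ω(S)` of all infinite external behaviours of `S`. -/
def behaviours : Set (ℕ → Y) := ⋃ x ∈ S.init, S.behavioursFrom x

/-- The probability that `S_b` behaviourally includes `S_a`, for an initial state of `S_a` drawn
from `P`, i.e. `P [B^ω(S_a(x₀)) ⊆ B^ω(S_b)]`. -/
def inclusionProb {X' : Type*} [MeasurableSpace X] (Sa : TransSystem X Y) (P : Measure X)
    (Sb : TransSystem X' Y) : ℝ :=
  P.real {x₀ | Sa.behavioursFrom x₀ ⊆ Sb.behaviours}

end TransSystem

/-- The embedding of a dynamical system as a transition system on its domain. A trajectory that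
stays in the domain gives the only infinite behaviour from its initial state; a trajectory that
leaves the domain gives none (the embedding is non-blocking iff `f` maps `D` into `D`). -/
def DynSystem.embedding {n : ℕ} {Y : Type*} (sys : DynSystem n Y) :
    TransSystem sys.domain Y where
  init := Set.univ
  edge x x' := (x' : EuclideanSpace ℝ (Fin n)) = sys.flow x
  out x := sys.out x

/-- The `ℓ`-complete transition system with a given state set `W` of `ℓ`-sequences: all states are
initial, the transitions follow the domino rule `kσ → σk'`, and the output of `kσ` is `k`. -/
def lComplete {Y : Type*} {ℓ : ℕ} (hℓ : 1 ≤ ℓ) (W : Set (Fin ℓ → Y)) : TransSystem W Y where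
  init := Set.univ
  edge w w' := ∀ (i : ℕ) (hi : i + 1 < ℓ), w.1 ⟨i + 1, hi⟩ = w'.1 ⟨i, by omega⟩
  out w := w.1 ⟨0, hℓ⟩

/-! ### Sampling and the scenario program -/

/-- The sequence `r` contains `p` as a block of consecutive entries. -/
def Exhibits {Y : Type*} {H ℓ : ℕ} (r : Fin H → Y) (p : Fin ℓ → Y) : Prop :=
  ∃ (k : ℕ) (hk : k + ℓ ≤ H), ∀ i : Fin ℓ, r ⟨k + i, by omega⟩ = p i

namespace DynSystem

variable {n : ℕ} {Y : Type*} (sys : DynSystem n Y)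

/-- `X_ℓ^N`: the `ℓ`-sequences witnessed in the `N` sampled trajectories of length `H`. -/
def witnessed {N : ℕ} (H ℓ : ℕ) (x : Fin N → sys.domain) : Set (Fin ℓ → Y) :=
  {w | ∃ i, Exhibits (sys.finiteBehaviour H (x i)) w}

/-- The data-driven `ℓ`-complete abstraction `S_ℓ^N`. -/
def dataAbstraction {N : ℕ} (H : ℕ) {ℓ : ℕ} (hℓ : 1 ≤ ℓ) (x : Fin N → sys.domain) :
    TransSystem (sys.witnessed H ℓ x) Y :=
  lComplete hℓ (sys.witnessed H ℓ x)

open Classical in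
/-- The scenario `δ ∈ {0,1}^{Y^ℓ}` produced by the initial state `x`. -/
def scenario (H ℓ : ℕ) (x : sys.domain) (w : Fin ℓ → Y) : ℝ :=
  if Exhibits (sys.finiteBehaviour H x) w then 1 else 0

end DynSystem

/-- `θ` satisfies the constraints `θ - δ_i ≥ 0` for all `i ∈ I`. -/
def ScenarioFeasible {ι κ : Type*} (δ : ι → κ → ℝ) (I : Finset ι) (θ : κ → ℝ) : Prop :=
  ∀ i ∈ I, ∀ w, 0 ≤ θ w - δ i w

/-- `θ` solves the scenario program: minimise `∑ θ` subject to `θ - δ_i ≥ 0` for all `i ∈ I`. -/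
def IsScenarioSolution {ι κ : Type*} [Fintype κ] (δ : ι → κ → ℝ) (I : Finset ι) (θ : κ → ℝ) :
    Prop :=
  ScenarioFeasible δ I θ ∧ ∀ θ', ScenarioFeasible δ I θ' → ∑ w, θ w ≤ ∑ w, θ' w

/-- The complexity `s*_N`: the least number of scenarios among `δ_1, …, δ_N` that yield the same
solution of the scenario program as all of them. -/
def scenarioComplexity {N : ℕ} {κ : Type*} [Fintype κ] (δ : Fin N → κ → ℝ) : ℕ :=
  sInf {m | ∃ I : Finset (Fin N), I.card = m ∧
    ∀ θ, IsScenarioSolution δ I θ ↔ IsScenarioSolution δ Finset.univ θ}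

/-- `t` solves the polynomial equation
`C(N,k) t^(N-k) - (β/N) ∑_{m=k}^{N-1} C(m,k) t^(m-k) = 0`. -/
def IsScenarioRoot (β : ℝ) (N k : ℕ) (t : ℝ) : Prop :=
  (N.choose k : ℝ) * t ^ (N - k)
    - β / N * ∑ m ∈ Finset.Ico k N, (m.choose k : ℝ) * t ^ (m - k) = 0

/-- The scenario bound `ε(k, β, N)`: it is `1 - t`, where `t` is the unique root of the polynomial
equation in `(0,1)`, if `k < N`, and `1` if `k = N`. -/
def scenarioBound (k : ℕ) (β : ℝ) (N : ℕ) : ℝ :=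
  if k < N then 1 - sSup {t | t ∈ Set.Ioo (0 : ℝ) 1 ∧ IsScenarioRoot β N k t} else 1

end

/-! Let `A x` be the set of `ℓ`-sequences seen along the first `H` outputs from `x`. Since `φ kbar =
1`, almost every trajectory shows within `kbar + ℓ` outputs every `ℓ`-sequence it ever visits
(`ae_mem_exhibited`). So a fresh `z` with `A z` inside the sampled union `⋃ A (x i)` almost surely
has its behaviour included, and only the probability of this covering must be bounded.

The program's solution is the indicator of that union, so its complexity is the size `k` of a
smallest subfamily with the same union. Ties are broken by one fixed ranking, so the support `I` is
unique and remains the support of every `M` with `I ⊆ M`. If the coverage is below `τ`, the samples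
outside `M` are all covered, which independence prices at `τ ^ (N - |M|)` times the probability `d M
I` that `I` is the support of `M`. The polynomial equation is what makes these bounds, averaged over
all `M ⊇ I`, combine to one with prefactor `β / N`. Summing over `I`, each `M` contributes at most 1
because its support is unique, and the `N` values of `|M|` give `β`. -/

/-! ### Preferred supports of a finite family of sets -/

section PreferredSupport

variable {ι κ : Type*} [Fintype ι]

/-- An injective ranking of the finite subsets of `ι` that refines the cardinality. -/
noncomputable def supportRank (I : Finset ι) : ℕ ×ₗ ℕ :=
  toLex (I.card, Fintype.equivFin (Finset ι) I)

theorem supportRank_injective : Function.Injective (supportRank (ι := ι)) := by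
  intro I J h
  have h' := congrArg (fun p => (ofLex p).2) h
  simpa [supportRank, Fin.val_inj] using h'

theorem card_le_of_supportRank_le {I J : Finset ι} (h : supportRank I ≤ supportRank J) :
    I.card ≤ J.card := by
  rcases Prod.Lex.le_iff.1 h with h | h
  · exact h.le
  · exact h.1.le

/-- `I` is the lowest-ranked subset of `M` over which the sets `a i` have the same union as over
`M`. -/
def IsPreferredSupport (a : ι → Set κ) (M I : Finset ι) : Prop :=
  (I ⊆ M ∧ ⋃ i ∈ I, a i = ⋃ i ∈ M, a i) ∧
    ∀ J ⊆ M, ⋃ i ∈ J, a i = ⋃ i ∈ M, a i → supportRank I ≤ supportRank J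

namespace IsPreferredSupport

variable {a b : ι → Set κ} {M M' I J : Finset ι}

theorem exists_of (a : ι → Set κ) (M : Finset ι) : ∃ I, IsPreferredSupport a M I := by
  classical
  obtain ⟨I, hI, hmin⟩ := Finset.exists_min_image
    (M.powerset.filter fun I => ⋃ i ∈ I, a i = ⋃ i ∈ M, a i) supportRank ⟨M, by simp⟩
  simp only [Finset.mem_filter, Finset.mem_powerset] at hI hmin
  exact ⟨I, hI, fun J hJ h => hmin J ⟨hJ, h⟩⟩

theorem unique (hI : IsPreferredSupport a M I) (hJ : IsPreferredSupport a M J) : I = J :=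
  supportRank_injective (le_antisymm (hI.2 J hJ.1.1 hJ.1.2) (hJ.2 I hI.1.1 hI.1.2))

/-- The union over `M` is squeezed between those over `I` and `M'`, so the competitors within `M`
are already competitors within `M'`. This needs a ranking that does not depend on `M`. -/
theorem mono (hI : IsPreferredSupport a M' I) (hIM : I ⊆ M) (hM : M ⊆ M') :
    IsPreferredSupport a M I := by
  have hM' : ⋃ i ∈ M, a i = ⋃ i ∈ M', a i :=
    (Set.biUnion_subset_biUnion_left hM).antisymm
      (hI.1.2.symm.subset.trans (Set.biUnion_subset_biUnion_left hIM))
  exact ⟨⟨hIM, hI.1.2.trans hM'.symm⟩, fun J hJ h => hI.2 J (hJ.trans hM) (h.trans hM')⟩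

theorem congr (hab : ∀ i ∈ M, a i = b i) (hI : IsPreferredSupport a M I) :
    IsPreferredSupport b M I := by
  have key : ∀ J ⊆ M, ⋃ i ∈ J, a i = ⋃ i ∈ J, b i := fun J hJ =>
    Set.iUnion₂_congr fun i hi => hab i (hJ hi)
  refine ⟨⟨hI.1.1, ?_⟩, fun J hJ h => hI.2 J hJ ?_⟩
  · rw [← key I hI.1.1, ← key M subset_rfl, hI.1.2]
  · rw [key J hJ, key M subset_rfl, h]

theorem subset_biUnion (hI : IsPreferredSupport a M I) {j : ι} (hj : j ∈ M) :
    a j ⊆ ⋃ i ∈ I, a i := by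
  rw [hI.1.2]
  exact Set.subset_biUnion_of_mem (u := a) (show j ∈ (M : Set ι) from hj)

end IsPreferredSupport

end PreferredSupport

/-! ### Product measures -/

section ProductMeasure

variable {ι Ω : Type*} [Fintype ι] [MeasurableSpace Ω]

/-- Independence of an event that depends on the coordinates in `M` from the event that all the
other coordinates lie in `C`. -/
theorem pi_inter_forall_notMem (P : Measure Ω) [IsProbabilityMeasure P] (M : Finset ι)
    {B : Set (ι → Ω)} (hB : MeasurableSet B)
    (hBM : ∀ x y : ι → Ω, (∀ i ∈ M, x i = y i) → x ∈ B → y ∈ B)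
    {C : Set Ω} (hC : MeasurableSet C) :
    (Measure.pi fun _ : ι => P).real (B ∩ {x | ∀ j ∉ M, x j ∈ C})
      = (Measure.pi fun _ : ι => P).real B * P.real C ^ (Fintype.card ι - M.card) := by
  classical
  obtain ⟨ω⟩ := P.nonempty_of_neZero
  have hind := (ProbabilityTheory.iIndepFun_pi (μ := fun _ : ι => P)
    (X := fun _ ω => ω) fun _ => aemeasurable_id).indepFun_finset M Mᶜ disjoint_compl_right
    fun i => measurable_pi_apply i
  -- Padding with an arbitrary `ω` exhibits `B` as the preimage of a measurable set under
  -- restriction to `M`.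
  let E : (M → Ω) → ι → Ω := fun y i => if h : i ∈ M then y ⟨i, h⟩ else ω
  have hE : Measurable E := by
    refine measurable_pi_lambda _ fun i => ?_
    by_cases h : i ∈ M
    · simpa [E, h] using measurable_pi_apply _
    · simp [E, h]
  have hBE : (fun (x : ι → Ω) (i : M) => x i) ⁻¹' (E ⁻¹' B) = B := by
    ext x
    exact ⟨hBM _ _ fun i hi => by simp [E, hi], hBM _ _ fun i hi => by simp [E, hi]⟩
  have hC' : (fun (x : ι → Ω) (i : (Mᶜ : Finset ι)) => x i) ⁻¹' (Set.univ.pi fun _ => C)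
      = {x | ∀ j ∉ M, x j ∈ C} := by
    ext x; simp
  have h := hind.measure_inter_preimage_eq_mul _ _ (hE hB)
    (MeasurableSet.univ_pi fun _ : (Mᶜ : Finset ι) => hC)
  rw [hBE, hC'] at h
  have hpi : {x : ι → Ω | ∀ j ∉ M, x j ∈ C}
      = Set.univ.pi fun j => if j ∈ M then Set.univ else C := by
    ext x
    simp only [Set.mem_ofPred_eq, Set.mem_univ_pi]
    refine forall_congr' fun j => ?_
    by_cases hj : j ∈ M <;> simp [hj]
  have hval : (Measure.pi fun _ : ι => P) {x : ι → Ω | ∀ j ∉ M, x j ∈ C}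
      = P C ^ (Fintype.card ι - M.card) := by
    rw [hpi, Measure.pi_pi, ← Finset.card_compl, ← Finset.prod_const,
      ← Finset.prod_mul_prod_compl M,
      Finset.prod_eq_one (s := M) fun i hi => by simp [hi], one_mul]
    exact Finset.prod_congr rfl fun i hi => by simp [Finset.mem_compl.1 hi]
  rw [measureReal_def, h, hval, ENNReal.toReal_mul, ENNReal.toReal_pow]
  rfl

end ProductMeasure

/-! ### The scenario bound for finite families of sets -/

section Scenario

variable {ι κ Ω : Type*} [Fintype ι] [Finite κ] [MeasurableSpace Ω]

theorem measurableSet_sample {A : Ω → Set κ} (hA : Measurable A) (p : (ι → Set κ) → Prop) :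
    MeasurableSet {x : ι → Ω | p fun i => A (x i)} := by
  have h : Measurable fun (x : ι → Ω) i => A (x i) :=
    measurable_pi_lambda _ fun i => hA.comp (measurable_pi_apply i)
  exact h (Set.toFinite {a | p a}).measurableSet

theorem measurableSet_subset {A : Ω → Set κ} (hA : Measurable A) (u : Set κ) :
    MeasurableSet {x | A x ⊆ u} :=
  hA (Set.toFinite {a : Set κ | a ⊆ u}).measurableSet

/-- Once the value `u` of the union over `I` is fixed, the coverage of `u` is a constant, and the
event for `M` is independent of the samples outside `M`, each of which lies under `u` with
probability below `τ`. There are finitely many `u`, and their events are disjoint. -/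
theorem measureReal_preferredSupport_violation_le (P : Measure Ω) [IsProbabilityMeasure P]
    {A : Ω → Set κ} (hA : Measurable A) {τ : ℝ} (hτ : 0 < τ)
    {I M : Finset ι} (hIM : I ⊆ M) :
    (Measure.pi fun _ : ι => P).real {x | IsPreferredSupport (fun i => A (x i)) Finset.univ I ∧
        P.real {z | A z ⊆ ⋃ i ∈ I, A (x i)} < τ}
      ≤ τ ^ (Fintype.card ι - M.card) *
        (Measure.pi fun _ : ι => P).real {x | IsPreferredSupport (fun i => A (x i)) M I} := by
  classical
  set Q := Measure.pi fun _ : ι => P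
  have := Fintype.ofFinite (Set κ)
  let B : Set κ → Set (ι → Ω) := fun u =>
    {x | IsPreferredSupport (fun i => A (x i)) M I ∧ ⋃ i ∈ I, A (x i) = u}
  have hB : ∀ u, MeasurableSet (B u) := fun u =>
    measurableSet_sample hA fun a => IsPreferredSupport a M I ∧ ⋃ i ∈ I, a i = u
  let s : Finset (Set κ) := Finset.univ.filter fun u => P.real {z | A z ⊆ u} < τ
  have hBM : ∀ u, ∀ x y : ι → Ω, (∀ i ∈ M, x i = y i) → x ∈ B u → y ∈ B u := by
    rintro u x y hxy ⟨h₁, h₂⟩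
    refine ⟨h₁.congr fun i hi => by rw [hxy i hi], ?_⟩
    rw [← h₂]
    exact Set.iUnion₂_congr fun i hi => by rw [hxy i (hIM hi)]
  calc _ ≤ Q.real (⋃ u ∈ s, B u ∩ {x | ∀ j ∉ M, x j ∈ {z | A z ⊆ u}}) := by
        refine measureReal_mono ?_ (measure_ne_top _ _)
        rintro x ⟨h₁, h₂⟩
        simp only [Set.mem_iUnion]
        exact ⟨_, Finset.mem_filter.2 ⟨Finset.mem_univ _, h₂⟩,
          ⟨h₁.mono hIM (Finset.subset_univ M), rfl⟩,
          fun j _ => h₁.subset_biUnion (Finset.mem_univ j)⟩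
    _ ≤ ∑ u ∈ s, Q.real (B u ∩ {x | ∀ j ∉ M, x j ∈ {z | A z ⊆ u}}) :=
        measureReal_biUnion_finset_le _ _
    _ ≤ ∑ u ∈ s, τ ^ (Fintype.card ι - M.card) * Q.real (B u) := by
        refine Finset.sum_le_sum fun u hu => ?_
        rw [pi_inter_forall_notMem P M (hB u) (hBM u) (measurableSet_subset hA u), mul_comm]
        gcongr
        exact (Finset.mem_filter.1 hu).2.le
    _ = τ ^ (Fintype.card ι - M.card) * Q.real (⋃ u ∈ s, B u) := by
        rw [← Finset.mul_sum, measureReal_biUnion_finset _ fun u _ => hB u]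
        intro u _ v _ huv
        exact Set.disjoint_left.2 fun x hu hv => huv (hu.2.symm.trans hv.2)
    _ ≤ _ := by
        gcongr
        · exact measure_ne_top _ _
        · exact Set.iUnion₂_subset fun u _ x hx => hx.1

/-- The map `K ↦ I ∪ K` is injective on subsets of the complement of `I`. -/
theorem choose_le_card_superset [DecidableEq ι] (I : Finset ι) {m : ℕ} (hm : I.card ≤ m) :
    (Fintype.card ι - I.card).choose (m - I.card)
      ≤ ((Finset.powersetCard m Finset.univ).filter (I ⊆ ·)).card := by
  rw [← Finset.card_compl, ← Finset.card_powersetCard]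
  refine Finset.card_le_card_of_injOn (I ∪ ·) (fun K hK => ?_) fun K hK L hL h => ?_
  · obtain ⟨hKI, hK⟩ := Finset.mem_powersetCard.1 hK
    have hd : Disjoint I K :=
      Finset.disjoint_left.2 fun i hi hiK => Finset.mem_compl.1 (hKI hiK) hi
    simp only [Finset.coe_filter, Finset.mem_powersetCard, Set.mem_ofPred_eq]
    refine ⟨⟨Finset.subset_univ _, ?_⟩, Finset.subset_union_left⟩
    rw [Finset.card_union_of_disjoint hd, hK]
    omega
  · have hKI := (Finset.mem_powersetCard.1 hK).1
    have hLI := (Finset.mem_powersetCard.1 hL).1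
    ext i
    have hi := Finset.ext_iff.1 h i
    simp only [Finset.mem_union] at hi
    have h₁ := @hKI i
    have h₂ := @hLI i
    simp only [Finset.mem_compl] at h₁ h₂
    tauto

/-- Averaging over the supersets of `I` by means of the polynomial equation. -/
theorem le_sum_superset_of_isScenarioRoot [DecidableEq ι] {β τ c : ℝ} (hβ : 0 ≤ β) (hτ : 0 < τ)
    {I : Finset ι} (hI : I.card < Fintype.card ι)
    (hroot : IsScenarioRoot β (Fintype.card ι) I.card τ) {d : Finset ι → ℝ} (hd : ∀ M, 0 ≤ d M)
    (hcd : ∀ M, I ⊆ M → c ≤ τ ^ (Fintype.card ι - M.card) * d M) :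
    c ≤ β / Fintype.card ι * ∑ m ∈ Finset.range (Fintype.card ι),
      ((Fintype.card ι).choose m : ℝ)⁻¹ *
        ∑ M ∈ (Finset.powersetCard m Finset.univ).filter (I ⊆ ·), d M := by
  set N := Fintype.card ι
  set k := I.card
  -- Replacing the number of supersets by a binomial coefficient needs `0 ≤ c`.
  rcases lt_or_ge c 0 with hc | hc
  · exact hc.le.trans <| mul_nonneg (by positivity) <| Finset.sum_nonneg fun m _ =>
      mul_nonneg (by positivity) (Finset.sum_nonneg fun M _ => hd M)
  have hCk : (0 : ℝ) < N.choose k := by exact_mod_cast Nat.choose_pos hI.le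
  -- The left side is `c` times the `m`-th term of the polynomial equation, normalised by its
  -- leading term; `C(N,m) C(m,k) = C(N,k) C(N-k,m-k)` matches it with the average over sets of size
  -- `m`.
  have hmain : ∀ m ∈ Finset.Ico k N, c / (N.choose k * τ ^ (N - k)) * (m.choose k * τ ^ (m - k))
      ≤ (N.choose m : ℝ)⁻¹ * ∑ M ∈ (Finset.powersetCard m Finset.univ).filter (I ⊆ ·), d M := by
    intro m hm
    obtain ⟨hkm, hmN⟩ := Finset.mem_Ico.1 hm
    have hCm : (0 : ℝ) < N.choose m := by exact_mod_cast Nat.choose_pos hmN.le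
    have hmul : (N.choose m : ℝ) * m.choose k = N.choose k * (N - k).choose (m - k) := by
      exact_mod_cast Nat.choose_mul hkm
    have hpow : τ ^ (N - k) = τ ^ (N - m) * τ ^ (m - k) := by
      rw [← pow_add]; congr 1; omega
    have hsum : ((N - k).choose (m - k) : ℝ) * (c / τ ^ (N - m))
        ≤ ∑ M ∈ (Finset.powersetCard m Finset.univ).filter (I ⊆ ·), d M := by
      refine le_trans ?_ (Finset.card_nsmul_le_sum _ _ (c / τ ^ (N - m)) fun M hM => ?_)
      · rw [nsmul_eq_mul]
        gcongr
        exact choose_le_card_superset I hkm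
      · obtain ⟨hM, hIM⟩ := Finset.mem_filter.1 hM
        rw [div_le_iff₀' (by positivity), ← (Finset.mem_powersetCard.1 hM).2]
        exact hcd M hIM
    rw [inv_mul_eq_div, le_div_iff₀ hCm]
    refine le_trans (le_of_eq ?_) hsum
    rw [hpow]
    field_simp
    linear_combination c * hmul
  have hroot' : (N.choose k : ℝ) * τ ^ (N - k)
      = β / N * ∑ m ∈ Finset.Ico k N, (m.choose k : ℝ) * τ ^ (m - k) := sub_eq_zero.1 hroot
  calc c = c / (N.choose k * τ ^ (N - k)) * (N.choose k * τ ^ (N - k)) := by field_simp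
    _ = β / N * ∑ m ∈ Finset.Ico k N,
          c / (N.choose k * τ ^ (N - k)) * (m.choose k * τ ^ (m - k)) := by
        rw [← Finset.mul_sum]
        nth_rewrite 2 [hroot']
        ring
    _ ≤ β / N * ∑ m ∈ Finset.Ico k N, (N.choose m : ℝ)⁻¹ *
          ∑ M ∈ (Finset.powersetCard m Finset.univ).filter (I ⊆ ·), d M := by
        exact mul_le_mul_of_nonneg_left (Finset.sum_le_sum hmain) (by positivity)
    _ ≤ _ := by
        gcongr
        · exact fun m _ _ => mul_nonneg (by positivity) (Finset.sum_nonneg fun M _ => hd M)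
        · exact fun m hm => Finset.mem_range.2 (Finset.mem_Ico.1 hm).2

theorem sum_measureReal_preferredSupport_le (P : Measure Ω) [IsProbabilityMeasure P]
    {A : Ω → Set κ} (hA : Measurable A) (M : Finset ι) (s : Finset (Finset ι)) :
    ∑ I ∈ s, (Measure.pi fun _ : ι => P).real {x | IsPreferredSupport (fun i => A (x i)) M I}
      ≤ 1 := by
  rw [← measureReal_biUnion_finset]
  · exact measureReal_le_one
  · exact fun I _ J _ hIJ => Set.disjoint_left.2 fun x hI hJ =>
      hIJ (IsPreferredSupport.unique hI hJ)
  · exact fun I _ => measurableSet_sample hA fun a => IsPreferredSupport a M I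

/-- The probability that a fresh sample is covered by the union of the sampled sets is, except on
an event of probability at most `β`, at least the root that belongs to the size of the preferred
support. -/
theorem measureReal_exists_preferredSupport_violation_le (P : Measure Ω) [IsProbabilityMeasure P]
    {A : Ω → Set κ} (hA : Measurable A) {β : ℝ} (hβ : 0 ≤ β) {τ : ℕ → ℝ}
    (hτ : ∀ k < Fintype.card ι, 0 < τ k → IsScenarioRoot β (Fintype.card ι) k (τ k)) :
    (Measure.pi fun _ : ι => P).real {x | ∃ I : Finset ι, I.card < Fintype.card ι ∧
        IsPreferredSupport (fun i => A (x i)) Finset.univ I ∧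
        P.real {z | A z ⊆ ⋃ i ∈ I, A (x i)} < τ I.card} ≤ β := by
  classical
  set N := Fintype.card ι
  let d : Finset ι → Finset ι → ℝ := fun M I =>
    (Measure.pi fun _ : ι => P).real {x | IsPreferredSupport (fun i => A (x i)) M I}
  -- Supports with `τ I.card ≤ 0` can be dropped, as no probability is below such a threshold.
  let s : Finset (Finset ι) := Finset.univ.filter fun I => I.card < N ∧ 0 < τ I.card
  calc _ ≤ (Measure.pi fun _ : ι => P).real (⋃ I ∈ s,
          {x | IsPreferredSupport (fun i => A (x i)) Finset.univ I ∧
            P.real {z | A z ⊆ ⋃ i ∈ I, A (x i)} < τ I.card}) := by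
        refine measureReal_mono ?_ (measure_ne_top _ _)
        rintro x ⟨I, hI, hx⟩
        simp only [Set.mem_iUnion]
        exact ⟨I, Finset.mem_filter.2 ⟨Finset.mem_univ I, hI, measureReal_nonneg.trans_lt hx.2⟩, hx⟩
    _ ≤ ∑ I ∈ s, β / N * ∑ m ∈ Finset.range N, (N.choose m : ℝ)⁻¹ *
          ∑ M ∈ (Finset.powersetCard m Finset.univ).filter (I ⊆ ·), d M I := by
        refine (measureReal_biUnion_finset_le _ _).trans (Finset.sum_le_sum fun I hI => ?_)
        obtain ⟨-, hIN, hpos⟩ := Finset.mem_filter.1 hI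
        exact le_sum_superset_of_isScenarioRoot hβ hpos hIN (hτ _ hIN hpos)
          (fun M => measureReal_nonneg)
          fun M hIM => measureReal_preferredSupport_violation_le P hA hpos hIM
    -- Dropping `I ⊆ M` lets the sums be exchanged.
    _ ≤ ∑ I ∈ s, β / N * ∑ m ∈ Finset.range N, (N.choose m : ℝ)⁻¹ *
          ∑ M ∈ Finset.powersetCard m Finset.univ, d M I := by
        gcongr
        exact Finset.filter_subset _ _
    _ = β / N * ∑ m ∈ Finset.range N, (N.choose m : ℝ)⁻¹ *
          ∑ M ∈ Finset.powersetCard m Finset.univ, ∑ I ∈ s, d M I := by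
        rw [← Finset.mul_sum, Finset.sum_comm]
        simp_rw [← Finset.mul_sum]
        congr! 3
        rw [Finset.sum_comm]
    _ ≤ β / N * ∑ m ∈ Finset.range N, (N.choose m : ℝ)⁻¹ *
          ∑ M ∈ Finset.powersetCard m (Finset.univ : Finset ι), 1 := by
        gcongr with m _ M _
        exact sum_measureReal_preferredSupport_le P hA M s
    _ = β / N * ∑ m ∈ Finset.range N, (1 : ℝ) := by
        congr 1
        refine Finset.sum_congr rfl fun m hm => ?_
        have : (0 : ℝ) < N.choose m := by
          exact_mod_cast Nat.choose_pos (Finset.mem_range.1 hm).le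
        rw [Finset.sum_const, Finset.card_powersetCard, Finset.card_univ, nsmul_eq_mul, mul_one]
        exact inv_mul_cancel₀ this.ne'
    _ ≤ β := by
        rw [Finset.sum_const, Finset.card_range, nsmul_eq_mul, mul_one]
        rcases eq_or_ne (N : ℝ) 0 with hN | hN
        · simpa [hN] using hβ
        · rw [div_mul_cancel₀ _ hN]

end Scenario

/-! ### The scenario program -/

section ScenarioProgram

/-- Uniqueness of the root is not needed: a positive supremum rules out the empty set, whose `sSup`
is 0, and the zero set of a polynomial is closed. -/
theorem isScenarioRoot_sSup {β : ℝ} {N k : ℕ}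
    (h : 0 < sSup {t | t ∈ Set.Ioo (0 : ℝ) 1 ∧ IsScenarioRoot β N k t}) :
    IsScenarioRoot β N k (sSup {t | t ∈ Set.Ioo (0 : ℝ) 1 ∧ IsScenarioRoot β N k t}) := by
  set s := {t | t ∈ Set.Ioo (0 : ℝ) 1 ∧ IsScenarioRoot β N k t}
  have hne : s.Nonempty := by
    by_contra hne
    simp [Set.not_nonempty_iff_eq_empty.1 hne] at h
  have hcl : IsClosed {t | IsScenarioRoot β N k t} := by
    unfold IsScenarioRoot
    exact isClosed_eq (by fun_prop) continuous_const
  exact closure_minimal (fun t ht => ht.2) hcl (csSup_mem_closure hne ⟨1, fun t ht => ht.1.2.le⟩)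

variable {ι κ : Type*} [Fintype κ]

open Classical in
/-- Over a nonempty set of constraints the scenario program has exactly one solution, the indicator
of the union of the constraint sets. -/
theorem isScenarioSolution_iff (A : ι → Set κ) {I : Finset ι} (hI : I.Nonempty) (θ : κ → ℝ) :
    IsScenarioSolution (fun i w => if w ∈ A i then (1 : ℝ) else 0) I θ ↔
      θ = (⋃ i ∈ I, A i).indicator 1 := by
  have hfeas : ScenarioFeasible (fun i w => if w ∈ A i then (1 : ℝ) else 0) I
      ((⋃ i ∈ I, A i).indicator 1) := by
    intro i hi w
    by_cases hw : w ∈ A i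
    · have : w ∈ ⋃ i ∈ I, A i := Set.mem_biUnion (show i ∈ (I : Set ι) from hi) hw
      rw [Set.indicator_of_mem this]
      simp [hw]
    · simp only [hw, if_false, sub_zero]
      exact Set.indicator_nonneg (fun _ _ => zero_le_one) w
  have hle : ∀ θ, ScenarioFeasible (fun i w => if w ∈ A i then (1 : ℝ) else 0) I θ →
      ∀ w, (⋃ i ∈ I, A i).indicator 1 w ≤ θ w := by
    intro θ hθ w
    by_cases hw : w ∈ ⋃ i ∈ I, A i
    · rw [Set.indicator_of_mem hw]
      obtain ⟨i, hi, hiw⟩ := Set.mem_iUnion₂.1 hw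
      simpa [hiw] using hθ i hi w
    · rw [Set.indicator_of_notMem hw]
      obtain ⟨i, hi⟩ := hI
      have : w ∉ A i := fun h => hw (Set.mem_biUnion (show i ∈ (I : Set ι) from hi) h)
      simpa [this] using hθ i hi w
  constructor
  · rintro ⟨h₁, h₂⟩
    have hsum : ∑ w, (⋃ i ∈ I, A i).indicator 1 w = ∑ w, θ w :=
      (Finset.sum_le_sum fun w _ => hle θ h₁ w).antisymm (h₂ _ hfeas)
    funext w
    exact ((Finset.sum_eq_sum_iff_of_le fun w _ => hle θ h₁ w).1 hsum w (Finset.mem_univ w)).symm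
  · rintro rfl
    exact ⟨hfeas, fun θ' h => Finset.sum_le_sum fun w _ => hle θ' h w⟩

/-- Without constraints the objective is unbounded below. -/
theorem not_isScenarioSolution_empty [Nonempty κ] (δ : ι → κ → ℝ) (θ : κ → ℝ) :
    ¬ IsScenarioSolution δ ∅ θ := by
  intro h
  have h' := h.2 (fun w => θ w - 1) fun i hi => absurd hi (Finset.notMem_empty i)
  rw [Finset.sum_sub_distrib] at h'
  have : (0 : ℝ) < ∑ _w : κ, 1 := by simp [Fintype.card_pos]
  linarith

open Classical in
-- Nonempty subfamilies have the same solution exactly when their unions agree. Nonempty `A i` keep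
-- the support nonempty, and the empty subfamily is excluded because its program has no solution.
theorem scenarioComplexity_eq_card {N : ℕ} {A : Fin N → Set κ} (hA : ∀ i, (A i).Nonempty)
    (hN : 0 < N) {I : Finset (Fin N)} (hI : IsPreferredSupport A Finset.univ I) :
    scenarioComplexity (fun i w => if w ∈ A i then (1 : ℝ) else 0) = I.card := by
  obtain ⟨w, hw⟩ := hA ⟨0, hN⟩
  have : Nonempty κ := ⟨w⟩
  have huniv : (Finset.univ : Finset (Fin N)).Nonempty := ⟨⟨0, hN⟩, Finset.mem_univ _⟩
  have hIne : I.Nonempty := by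
    obtain ⟨i, hi, -⟩ := Set.mem_iUnion₂.1 (hI.subset_biUnion (Finset.mem_univ ⟨0, hN⟩) hw)
    exact ⟨i, hi⟩
  have hmem : I.card ∈ {m | ∃ J : Finset (Fin N), J.card = m ∧
      ∀ θ, IsScenarioSolution (fun i w => if w ∈ A i then (1 : ℝ) else 0) J θ ↔
        IsScenarioSolution (fun i w => if w ∈ A i then (1 : ℝ) else 0) Finset.univ θ} :=
    ⟨I, rfl, fun θ => by
      rw [isScenarioSolution_iff A hIne, isScenarioSolution_iff A huniv, hI.1.2]⟩
  refine (Nat.sInf_le hmem).antisymm ?_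
  obtain ⟨J, hJ, hsol⟩ := Nat.sInf_mem ⟨_, hmem⟩
  have hJuniv := (hsol _).2 ((isScenarioSolution_iff A huniv _).2 rfl)
  have hJne : J.Nonempty := by
    by_contra h
    rw [Finset.not_nonempty_iff_eq_empty.1 h] at hJuniv
    exact not_isScenarioSolution_empty _ _ hJuniv
  rw [isScenarioSolution_iff A hJne] at hJuniv
  refine (card_le_of_supportRank_le (hI.2 J (Finset.subset_univ J) ?_)).trans_eq hJ
  exact (Set.indicator_one_inj ℝ hJuniv).symm

end ScenarioProgram

/-! ### Trajectories -/

namespace DynSystem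

variable {n : ℕ} {Y : Type*} (sys : DynSystem n Y)

open Classical in
/-- The flow, continued by `0` outside of the domain. -/
noncomputable def totalFlow (x : EuclideanSpace ℝ (Fin n)) : EuclideanSpace ℝ (Fin n) :=
  if x ∈ sys.domain then sys.flow x else 0

open Classical in
/-- The output map, continued by the exit symbol outside of the domain. -/
noncomputable def totalOut (x : EuclideanSpace ℝ (Fin n)) : Y :=
  if x ∈ sys.domain then sys.out x else sys.exitSymbol

/-- The flow is measurable only on the domain; agreement up to exit transfers measurability from the
iterates of the extension. -/
theorem totalFlow_iterate_eq (x : EuclideanSpace ℝ (Fin n)) {k : ℕ}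
    (h : ∀ j < k, sys.flow^[j] x ∈ sys.domain) : sys.totalFlow^[k] x = sys.flow^[k] x := by
  induction k with
  | zero => rfl
  | succ k ih =>
    rw [Function.iterate_succ_apply', Function.iterate_succ_apply',
      ih fun j hj => h j (hj.trans k.lt_succ_self), totalFlow, if_pos (h k k.lt_succ_self)]

theorem forall_totalFlow_mem_iff (x : EuclideanSpace ℝ (Fin n)) (k : ℕ) :
    (∀ j ≤ k, sys.totalFlow^[j] x ∈ sys.domain) ↔ ∀ j ≤ k, sys.flow^[j] x ∈ sys.domain := by
  constructor
  · intro h j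
    induction j using Nat.strong_induction_on with
    | _ j ih =>
      intro hj
      rw [← sys.totalFlow_iterate_eq x fun i hi => ih i hi (hi.le.trans hj)]
      exact h j hj
  · intro h j hj
    rw [sys.totalFlow_iterate_eq x fun i hi => h i (hi.le.trans hj)]
    exact h j hj

theorem output_eq_of_iterate {x z : sys.domain} {i : ℕ}
    (hx : ∀ j ≤ i, sys.flow^[j] x ∈ sys.domain)
    (hz : (z : EuclideanSpace ℝ (Fin n)) = sys.flow^[i] x) (j : ℕ) :
    sys.output x (i + j) = sys.output z j := by
  have hit : ∀ j, sys.flow^[j] z = sys.flow^[i + j] x := fun j => by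
    rw [hz, add_comm, Function.iterate_add_apply]
  have hiff : (∀ j' ≤ i + j, sys.flow^[j'] x ∈ sys.domain) ↔
      ∀ j' ≤ j, sys.flow^[j'] z ∈ sys.domain := by
    simp_rw [hit]
    refine ⟨fun h j' hj' => h _ (by omega), fun h j' hj' => ?_⟩
    rcases le_total j' i with hle | hle
    · exact hx j' hle
    · obtain ⟨m, rfl⟩ := Nat.exists_eq_add_of_le hle
      exact h m (by omega)
  rw [output, output, hit]
  by_cases h : ∀ j' ≤ j, sys.flow^[j'] z ∈ sys.domain
  · rw [if_pos h, if_pos (hiff.2 h)]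
  · rw [if_neg h, if_neg (mt hiff.1 h)]

/-- The `ℓ`-sequences that occur in the behaviour of length `H` from `x`. -/
def exhibited (H ℓ : ℕ) (x : sys.domain) : Set (Fin ℓ → Y) :=
  {w | Exhibits (sys.finiteBehaviour H x) w}

theorem exhibited_nonempty {H ℓ : ℕ} (h : ℓ ≤ H) (x : sys.domain) :
    (sys.exhibited H ℓ x).Nonempty :=
  ⟨fun i => sys.finiteBehaviour H x ⟨0 + i, by omega⟩, 0, by omega, fun _ => rfl⟩

theorem witnessed_eq {N : ℕ} (H ℓ : ℕ) (x : Fin N → sys.domain) :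
    sys.witnessed H ℓ x = ⋃ i ∈ (Finset.univ : Finset (Fin N)), sys.exhibited H ℓ (x i) := by
  ext w
  simp [witnessed, exhibited]

/-- The block starts at the visiting time `i ≤ kbar`, hence the horizon `kbar + ℓ`. -/
theorem mem_exhibited_of_mem_pre {kbar ℓ : ℕ} {x : sys.domain} {w : Fin ℓ → Y} {i : ℕ}
    (hi : i ≤ kbar) (h : x ∈ sys.pre i (sys.eqClass w)) :
    w ∈ sys.exhibited (kbar + ℓ) ℓ x := by
  obtain ⟨hx, z, hzw, hz⟩ := h
  refine ⟨i, by omega, fun j => ?_⟩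
  rw [← (show sys.finiteBehaviour ℓ z = w from hzw)]
  exact sys.output_eq_of_iterate hx hz j

/-- If the `ℓ`-sequences visited by the trajectory are all exhibited within `H` steps, then every
`ℓ`-complete system whose states include the exhibited sequences includes its behaviour. -/
theorem behavioursFrom_subset_lComplete {H ℓ : ℕ} (hℓ : 1 ≤ ℓ) {x : sys.domain}
    (hx : ∀ w i, x ∈ sys.pre i (sys.eqClass w) → w ∈ sys.exhibited H ℓ x)
    {u : Set (Fin ℓ → Y)} (hu : sys.exhibited H ℓ x ⊆ u) :
    sys.embedding.behavioursFrom x ⊆ (lComplete hℓ u).behaviours := by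
  rintro y ⟨r, hr0, hr, hy⟩
  have hit : ∀ i, (r i : EuclideanSpace ℝ (Fin n)) = sys.flow^[i] x := by
    intro i
    induction i with
    | zero => rw [hr0]; rfl
    | succ i ih => rw [Function.iterate_succ_apply', ← ih]; exact hr i
  have hdom : ∀ i, sys.flow^[i] x ∈ sys.domain := fun i => hit i ▸ (r i).2
  have hout : ∀ i, sys.output x i = y i := by
    intro i
    rw [output, if_pos fun j _ => hdom j, hy i, ← hit]
    rfl
  -- The matching run is the sliding window of outputs; consecutive windows overlap as the domino
  -- rule demands.
  let v : ℕ → Fin ℓ → Y := fun i j => y (i + j)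
  have hv : ∀ i, v i ∈ u := by
    refine fun i => hu (hx _ i ⟨fun j _ => hdom j, r i, ?_, hit i⟩)
    funext j
    exact (sys.output_eq_of_iterate (fun j _ => hdom j) (hit i) j).symm.trans (hout _)
  refine Set.mem_iUnion₂.2 ⟨⟨v 0, hv 0⟩, Set.mem_univ _, fun i => ⟨v i, hv i⟩, rfl, ?_,
    fun i => rfl⟩
  intro i j hj
  change y (i + (j + 1)) = y (i + 1 + j)
  congr 1
  omega

variable [MeasurableSpace Y] {sys}

namespace IsMeasurable

theorem measurable_totalFlow (h : sys.IsMeasurable) : Measurable sys.totalFlow := by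
  classical
  exact Measurable.dite (f := fun x : sys.domain => sys.flow x) (g := fun _ => 0) h.flow
    measurable_const h.domain

theorem measurable_totalOut (h : sys.IsMeasurable) : Measurable sys.totalOut := by
  classical
  exact Measurable.dite (f := fun x : sys.domain => sys.out x) (g := fun _ => sys.exitSymbol) h.out
    measurable_const h.domain

theorem measurableSet_forall_mem (h : sys.IsMeasurable) (k : ℕ) :
    MeasurableSet {x : sys.domain | ∀ j ≤ k, sys.flow^[j] x ∈ sys.domain} := by
  simp_rw [← sys.forall_totalFlow_mem_iff]
  have : {x : sys.domain | ∀ j ≤ k, sys.totalFlow^[j] x ∈ sys.domain}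
      = ⋂ j, ⋂ _ : j ≤ k, (fun x : sys.domain => sys.totalFlow^[j] x) ⁻¹' sys.domain := by
    ext; simp
  rw [this]
  exact MeasurableSet.iInter fun j => MeasurableSet.iInter fun _ =>
    ((h.measurable_totalFlow.iterate j).comp measurable_subtype_coe) h.domain

theorem measurable_output (h : sys.IsMeasurable) (k : ℕ) :
    Measurable fun x : sys.domain => sys.output x k := by
  classical
  have : (fun x : sys.domain => sys.output x k) = fun x : sys.domain =>
      if ∀ j ≤ k, sys.flow^[j] x ∈ sys.domain then sys.totalOut (sys.totalFlow^[k] x)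
      else sys.exitSymbol := by
    funext x
    by_cases hx : ∀ j ≤ k, sys.flow^[j] x ∈ sys.domain
    · rw [output, if_pos hx, if_pos hx, sys.totalFlow_iterate_eq x fun j hj => hx j hj.le, totalOut,
        if_pos (hx k le_rfl)]
    · rw [output, if_neg hx, if_neg hx]
  rw [this]
  exact Measurable.ite (h.measurableSet_forall_mem k) (h.measurable_totalOut.comp
    ((h.measurable_totalFlow.iterate k).comp measurable_subtype_coe)) measurable_const

theorem measurable_finiteBehaviour (h : sys.IsMeasurable) (H : ℕ) :
    Measurable (sys.finiteBehaviour H) :=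
  measurable_pi_lambda _ fun k => h.measurable_output k

theorem measurableSet_pre (h : sys.IsMeasurable) (i : ℕ) {S : Set sys.domain}
    (hS : MeasurableSet S) : MeasurableSet (sys.pre i S) := by
  have : sys.pre i S = {x : sys.domain | ∀ j ≤ i, sys.flow^[j] x ∈ sys.domain} ∩
      (fun x : sys.domain => sys.totalFlow^[i] x) ⁻¹' (Subtype.val '' S) := by
    ext x
    refine and_congr_right fun hx => ?_
    rw [Set.mem_preimage, sys.totalFlow_iterate_eq x fun j hj => hx j hj.le]
  rw [this]
  exact (h.measurableSet_forall_mem i).inter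
    (((h.measurable_totalFlow.iterate i).comp measurable_subtype_coe)
      ((MeasurableEmbedding.subtype_coe h.domain).measurableSet_image.2 hS))

variable [Finite Y] [MeasurableSingletonClass Y]

theorem measurable_exhibited (h : sys.IsMeasurable) (H ℓ : ℕ) :
    Measurable (sys.exhibited H ℓ) :=
  (measurable_of_finite fun r : Fin H → Y => {w : Fin ℓ → Y | Exhibits r w}).comp
    (h.measurable_finiteBehaviour H)

/-- Under the attractivity assumption with `φ kbar = 1`, almost every trajectory exhibits within
`kbar + ℓ` outputs all `ℓ`-sequences that it ever visits. -/
theorem ae_mem_exhibited (h : sys.IsMeasurable) {P : Measure sys.domain} [IsProbabilityMeasure P]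
    {ℓ : ℕ} {φ : ℕ → ℝ} (hφ : sys.AttractiveWith P ℓ φ) {kbar : ℕ} (hk : φ kbar = 1) :
    ∀ᵐ x ∂P, ∀ (w : Fin ℓ → Y) (i : ℕ), x ∈ sys.pre i (sys.eqClass w) →
      w ∈ sys.exhibited (kbar + ℓ) ℓ x := by
  refine ae_all_iff.2 fun w => ?_
  -- Singleton unions suffice: the early-visit event lies in the event of ever visiting and is at
  -- least as likely, so the two agree almost everywhere.
  have hle := hφ.2 kbar {w}
  rw [hk, one_mul, Set.biUnion_singleton, visitProbInfty, visitProb] at hle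
  have hmeas : MeasurableSet (sys.eqClass w) :=
    h.measurable_finiteBehaviour ℓ (measurableSet_singleton w)
  have hae := ae_eq_of_subset_of_measure_ge
    (μ := P) (s := ⋃ i ∈ Finset.range (kbar + 1), sys.pre i (sys.eqClass w))
    (t := ⋃ i, sys.pre i (sys.eqClass w))
    (Set.iUnion₂_subset fun i _ => Set.subset_iUnion (fun i => sys.pre i (sys.eqClass w)) i)
    ((ENNReal.toReal_le_toReal (measure_ne_top _ _) (measure_ne_top _ _)).1 hle)
    (Finset.measurableSet_biUnion _ fun i _ => h.measurableSet_pre i hmeas).nullMeasurableSet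
    (measure_ne_top _ _)
  filter_upwards [hae.mem_iff] with x hx i hi
  obtain ⟨j, hj, hxj⟩ := Set.mem_iUnion₂.1 (hx.2 (Set.mem_iUnion.2 ⟨i, hi⟩))
  exact sys.mem_exhibited_of_mem_pre (Nat.lt_succ_iff.1 (Finset.mem_range.1 hj)) hxj

end IsMeasurable

end DynSystem

theorem mainTheorem5 {n : ℕ} {Y : Type*} [Fintype Y] [MeasurableSpace Y]
    [MeasurableSingletonClass Y]
    (sys : DynSystem n Y) (hsys : sys.IsMeasurable)
    (P : Measure sys.domain) [IsProbabilityMeasure P]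
    (ℓ : ℕ) (hℓ : 1 ≤ ℓ)
    (φ : ℕ → ℝ) (hφ : sys.AttractiveWith P ℓ φ)
    (kbar : ℕ) (hkbar : φ kbar = 1)
    (H : ℕ) (hH : H = kbar + ℓ)
    (N : ℕ) (β : ℝ) (hβ : β ∈ Set.Ioo (0 : ℝ) 1) :
    1 - β ≤ (Measure.pi fun _ : Fin N => P).real
      {x | 1 - scenarioBound (scenarioComplexity fun i => sys.scenario H ℓ (x i)) β N
        ≤ sys.embedding.inclusionProb P (sys.dataAbstraction H hℓ x)} := by
  classical
  subst hH
  set H := kbar + ℓ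
  let τ : ℕ → ℝ := fun k => sSup {t | t ∈ Set.Ioo (0 : ℝ) 1 ∧ IsScenarioRoot β N k t}
  have hbad := measureReal_exists_preferredSupport_violation_le (ι := Fin N) P
    (hsys.measurable_exhibited H ℓ) hβ.1.le (τ := τ)
    (by rw [Fintype.card_fin]; exact fun k _ h => isScenarioRoot_sSup h)
  rw [Fintype.card_fin] at hbad
  set Q := Measure.pi fun _ : Fin N => P
  rw [sub_le_iff_le_add]
  refine le_trans ?_ (add_le_add_right hbad _)
  -- It remains to see that every sample outside the exceptional event is good.
  refine le_trans ?_ (measureReal_union_le _ _)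
  refine (probReal_univ (μ := Q)).symm.le.trans
    (measureReal_mono (fun x _ => ?_) (measure_ne_top _ _))
  refine or_iff_not_imp_right.2 fun hx => ?_
  obtain ⟨I, hI⟩ := IsPreferredSupport.exists_of (fun i => sys.exhibited H ℓ (x i)) Finset.univ
  have hnonneg : 0 ≤ sys.embedding.inclusionProb P (sys.dataAbstraction H hℓ x) :=
    measureReal_nonneg
  rw [Set.mem_ofPred_eq, scenarioBound]
  split_ifs with hlt
  · have hcomp : scenarioComplexity (fun i => sys.scenario H ℓ (x i)) = I.card :=
      scenarioComplexity_eq_card (fun i => sys.exhibited_nonempty (Nat.le_add_left ℓ kbar) (x i))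
        (Nat.zero_lt_of_lt hlt) hI
    rw [hcomp] at hlt ⊢
    have hle : τ I.card ≤ P.real {z | sys.exhibited H ℓ z ⊆ ⋃ i ∈ I, sys.exhibited H ℓ (x i)} :=
      not_lt.1 fun h => hx ⟨I, hlt, hI, h⟩
    rw [sub_sub_cancel]
    refine hle.trans (ENNReal.toReal_mono (measure_ne_top _ _) (measure_mono_ae ?_))
    filter_upwards [hsys.ae_mem_exhibited hφ hkbar] with z hz hzI
    refine sys.behavioursFrom_subset_lComplete hℓ hz ?_
    rw [sys.witnessed_eq, ← hI.1.2]
    exact hzI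
  -- Here the bound equals 1 and the claim is vacuous; this includes `N = 0`.
  · simpa using hnonneg
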